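/- Let $\mathbb R^\omega$ be the countable product of real lines with the product topology. A Borel set $A\subseteq\mathbb R^\omega$ is called Haar-null if there is a Borel probability measure $\mu$ on $\mathbb R^\omega$ with $\mu(x+A)=0$ for all $x\in\mathbb R^\omega$; it is called Haar-meager if there is a continuous map $f:\{0,1\}^\omega\to\mathbb R^\omega$ from the Cantor cube such that for every $x\in\mathbb R^\omega$ the preimage $f^{-1}[x+A]$ is meager in $\{0,1\}^\omega$. Theorem. There is a Borel linear subspace $L\subseteq\mathbb R^\omega$ that is both Haar-meager and Haar-null in $\mathbb R^\omega$, but that cannot be covered by countably many closed Haar-meager subsets of $\mathbb R^\omega$. -/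

import Mathlib

open MeasureTheory

/-- A subset `A` of a topological group `X` (written additively, not assumed commutative) is
*Haar-null* if it is Borel and there is a Borel probability measure `μ` on `X` such that
`μ (x + A + y) = 0` for all `x, y ∈ X`. -/
def IsHaarNull {X : Type*} [AddGroup X] [TopologicalSpace X] [MeasurableSpace X] [BorelSpace X]
    (A : Set X) : Prop :=
  MeasurableSet A ∧
    ∃ μ : Measure X, IsProbabilityMeasure μ ∧ ∀ x y : X, μ ((fun a => x + a + y) '' A) = 0

/-- A subset `A` of a topological group `X` (written additively, not assumed commutative) is
*Haar-meager* if it is Borel and there is a continuous map `f` from the Cantor cube `{0,1}^ω`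
to `X` such that the preimage `f⁻¹[x + A + y]` is meager in the Cantor cube
for all `x, y ∈ X`. -/
def IsHaarMeager {X : Type*} [AddGroup X] [TopologicalSpace X] [MeasurableSpace X] [BorelSpace X]
    (A : Set X) : Prop :=
  MeasurableSet A ∧
    ∃ f : (ℕ → Bool) → X, Continuous f ∧
      ∀ x y : X, IsMeagre (f ⁻¹' ((fun a => x + a + y) '' A))

/-!
The subspace is the linear span of a Borel set `selfCoding` of sequences which is large in the
sense of Baire category and yet linearly independent, even modulo bounded sequences.

Fix blocks `[t_j - j, t_j + j]` of reals, with `t_j` growing so fast that a linear combination of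
reals from blocks with distinct large indices is dominated by the term from the last block. The index
`j` of a block encodes a natural number `a ≤ j` together with an open box in some `ℝ^M`. A sequence
`x` belongs to `selfCoding` if each coordinate `x n` lies in a block whose index encodes a box of
side `2 / M` around `(x 0, …, x (M - 1))`, where `M → ∞` as `n → ∞`.

* Distinct self-coding sequences eventually encode distinct boxes, so their `n`-th coordinates lie in
  distinct blocks. A nontrivial linear combination of them is therefore unbounded
  (`eq_zero_of_bounded_sum_selfCoding`). Hence the span is proper: it omits the constant
  sequence `1`.
* The span of a linearly independent Borel set is Borel by the Lusin–Souslin theorem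
  (`LinearIndependent.measurableSet_span`), since a linear combination determines its nonzero
  coefficients and the increasing enumeration of its vectors.
* A proper Borel subspace is Haar-null and Haar-meager, since its translates meet the line through a
  vector outside it in at most one point.
* As `a` is arbitrary, the blocks that announce a given box have arbitrarily large radii. So every
  compact set in `ℝ^ω`, after restriction to a small part of it, has a translate that lies in a given
  box in finitely many coordinates and in blocks announcing this box in all others. Choosing in such
  a translate a point outside a given closed Haar-meager set, and iterating, one finds a self-coding
  sequence outside countably many given closed Haar-meager sets
  (`exists_mem_selfCoding_forall_notMem`).
-/

open Filter Topology Set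

/-! ### Proper Borel subspaces are small -/

lemma Set.Subsingleton.isMeagre_cantor {s : Set (ℕ → Bool)} (hs : s.Subsingleton) :
    IsMeagre s := by
  rcases hs.eq_empty_or_singleton with rfl | ⟨b, rfl⟩
  · exact IsMeagre.empty
  apply IsNowhereDense.isMeagre
  rw [IsNowhereDense, closure_singleton, Set.eq_empty_iff_forall_notMem]
  intro c hc
  obtain rfl : c = b := by simpa using interior_subset hc
  have hlim : Tendsto (fun n => Function.update c n (!c n)) atTop (𝓝 c) := by
    refine tendsto_pi_nhds.2 fun i => tendsto_const_nhds.congr' ?_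
    filter_upwards [eventually_gt_atTop i] with n hn
    simp [Function.update_of_ne hn.ne]
  obtain ⟨n, hn⟩ := (hlim.eventually (mem_interior_iff_mem_nhds.1 hc)).exists
  have := congrFun (Set.mem_singleton_iff.1 hn) n
  simp at this

section ProperSubspace

variable {E : Type*} [AddCommGroup E] [Module ℝ E] (L : Submodule ℝ E)

/-- A translate of a subspace meets the line through a vector outside the subspace in at most one
point. -/
lemma Submodule.subsingleton_smul_mem_translate {v : E} (hv : v ∉ L) (x y : E) :
    {t : ℝ | t • v ∈ (fun a => x + a + y) '' (L : Set E)}.Subsingleton := by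
  rintro s ⟨a, ha, hs⟩ t ⟨b, hb, ht⟩
  by_contra hst
  have h : (s - t) • v = a - b := by
    rw [sub_smul, ← hs, ← ht]; simp only []; abel
  have hmem : (s - t) • v ∈ L := h ▸ L.sub_mem ha hb
  exact hv ((L.smul_mem_iff (sub_ne_zero.2 hst)).1 hmem)

variable [TopologicalSpace E] [ContinuousSMul ℝ E]
  [MeasurableSpace E] [BorelSpace E]

/-- The witness is a Cantor set in a line transversal to `L`. -/
theorem Submodule.isHaarMeager_of_ne_top (hL : MeasurableSet (L : Set E)) (hne : L ≠ ⊤) :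
    IsHaarMeager (L : Set E) := by
  obtain ⟨v, -, hv⟩ := SetLike.exists_of_lt hne.lt_top
  obtain ⟨g, -, hgc, hgi⟩ :=
    (PerfectSpace.univ_perfect ℝ).exists_nat_bool_injection Set.univ_nonempty
  refine ⟨hL, fun b => g b • v, by fun_prop, fun x y => Set.Subsingleton.isMeagre_cantor ?_⟩
  exact fun b hb c hc => hgi (L.subsingleton_smul_mem_translate hv x y hb hc)

/-- The witness is Lebesgue measure on a segment of a line transversal to `L`. -/
theorem Submodule.isHaarNull_of_ne_top [IsTopologicalAddGroup E]
    (hL : MeasurableSet (L : Set E)) (hne : L ≠ ⊤) :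
    IsHaarNull (L : Set E) := by
  obtain ⟨v, -, hv⟩ := SetLike.exists_of_lt hne.lt_top
  have hm : Measurable fun t : ℝ => t • v :=
    (continuous_id.smul continuous_const : Continuous fun t : ℝ => t • v).measurable
  refine ⟨hL, (volume.restrict (Set.Icc (0 : ℝ) 1)).map fun t => t • v, ?_, fun x y => ?_⟩
  · have : IsProbabilityMeasure (volume.restrict (Set.Icc (0 : ℝ) 1)) := ⟨by simp⟩
    exact Measure.isProbabilityMeasure_map hm.aemeasurable
  · have hmeas : MeasurableSet ((fun a => x + a + y) '' (L : Set E)) := by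
      have h := ((Homeomorph.addLeft x).trans (Homeomorph.addRight y)).measurableEmbedding
      exact h.measurableSet_image.2 hL
    rw [Measure.map_apply hm hmeas]
    exact (L.subsingleton_smul_mem_translate hv x y).measure_zero _

end ProperSubspace

/-! ### Spans of Borel linearly independent families are Borel -/

/-- The span is the union over `r` of the images of the set `D r` of tuples of `r` nonzero coefficients
and `r` vectors in increasing order, for a Borel linear order on `α` pulled back from `ℝ`. By linear
independence these tuples are determined by the linear combination, so that the Lusin–Souslin theorem
applies. -/
theorem LinearIndependent.measurableSet_span {α E : Type*} [MeasurableSpace α]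
    [StandardBorelSpace α] [AddCommGroup E] [Module ℝ E] [MeasurableSpace E]
    [StandardBorelSpace E] [MeasurableAdd₂ E] [MeasurableSMul₂ ℝ E] {v : α → E}
    (hv : LinearIndependent ℝ v) (hm : Measurable v) :
    MeasurableSet (Submodule.span ℝ (Set.range v) : Set E) := by
  classical
  let e := embeddingReal α
  have he : MeasurableEmbedding e := measurableEmbedding_embeddingReal α
  let _ : LinearOrder α := LinearOrder.lift' e he.injective
  let D (r : ℕ) : Set ((Fin r → ℝ) × (Fin r → α)) := {p | (∀ i, p.1 i ≠ 0) ∧ StrictMono p.2}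
  let Φ (r : ℕ) (p : (Fin r → ℝ) × (Fin r → α)) : E := ∑ i, p.1 i • v (p.2 i)
  have hspan : (Submodule.span ℝ (Set.range v) : Set E) = ⋃ r, Φ r '' D r := by
    ext y
    simp only [SetLike.mem_coe, Set.mem_iUnion]
    constructor
    · rw [Finsupp.mem_span_range_iff_exists_finsupp]
      rintro ⟨l, rfl⟩
      let o := l.support.orderEmbOfFin rfl
      refine ⟨l.support.card, (fun i => l (o i), o), ⟨fun i => ?_, o.strictMono⟩, ?_⟩
      · exact Finsupp.mem_support_iff.1 (Finset.orderEmbOfFin_mem _ _ i)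
      · have himg : Finset.univ.map o.toEmbedding = l.support := Finset.map_orderEmbOfFin_univ _ _
        calc ∑ i, l (o i) • v (o i) = ∑ a ∈ Finset.univ.map o.toEmbedding, l a • v a :=
              (Finset.sum_map Finset.univ o.toEmbedding fun a => l a • v a).symm
          _ = l.sum fun a c => c • v a := by rw [himg, Finsupp.sum]
    · rintro ⟨r, p, -, rfl⟩
      exact Submodule.sum_mem _ fun i _ =>
        Submodule.smul_mem _ _ (Submodule.subset_span (Set.mem_range_self _))
  rw [hspan]
  refine MeasurableSet.iUnion fun r => ?_
  have hD : MeasurableSet (D r) := by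
    have h : D r = (⋂ i, {p | p.1 i ≠ 0}) ∩ ⋂ i, ⋂ j, ⋂ _ : i < j, {p | e (p.2 i) < e (p.2 j)} := by
      ext p
      simp only [D, StrictMono, Set.mem_inter_iff, Set.mem_iInter, Set.mem_ofPred_eq]
      rfl
    rw [h]
    refine .inter (.iInter fun i => ?_) (.iInter fun i => .iInter fun j => .iInter fun _ => ?_)
    · exact ((measurable_pi_apply i).comp measurable_fst) (measurableSet_singleton 0).compl
    · exact measurableSet_lt (he.measurable.comp ((measurable_pi_apply i).comp measurable_snd))
        (he.measurable.comp ((measurable_pi_apply j).comp measurable_snd))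
  have hΦ : Measurable (Φ r) := by
    refine Finset.measurable_sum _ fun i _ => ?_
    exact ((measurable_pi_apply i).comp measurable_fst).smul
      (hm.comp ((measurable_pi_apply i).comp measurable_snd))
  refine hD.image_of_measurable_injOn hΦ ?_
  -- The coefficients of a combination form a finitely supported function, determined by its
  -- value; the sorted enumeration of the support is then determined as well.
  let coeffs (p : (Fin r → ℝ) × (Fin r → α)) : α →₀ ℝ :=
    Finsupp.mapDomain p.2 (Finsupp.equivFunOnFinite.symm p.1)
  have hcoeffs (p) : Finsupp.linearCombination ℝ v (coeffs p) = Φ r p := by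
    rw [Finsupp.linearCombination_mapDomain, Finsupp.linearCombination_apply,
      Finsupp.sum_fintype _ _ (by simp)]
    rfl
  have hsupp {p} (hp : p ∈ D r) : ((coeffs p).support : Set α) = Set.range p.2 := by
    rw [Finsupp.mapDomain_support_of_injective hp.2.injective]
    have : (Finsupp.equivFunOnFinite.symm p.1).support = Finset.univ := by
      ext i; simpa using hp.1 i
    simp [this]
  intro p hp q hq hpq
  have hc : coeffs p = coeffs q := hv (by rw [hcoeffs, hcoeffs, hpq])
  have h2 : p.2 = q.2 := by
    rw [← hp.2.range_inj hq.2, ← hsupp hp, ← hsupp hq, hc]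
  refine Prod.ext ?_ h2
  funext i
  have h1 := DFunLike.congr_fun hc (p.2 i)
  simp only [coeffs] at h1
  rw [Finsupp.mapDomain_apply hp.2.injective, h2, Finsupp.mapDomain_apply hq.2.injective] at h1
  simpa using h1

/-! ### Lacunary blocks -/

/-- The center of the `j`-th block `[blockCenter j - j, blockCenter j + j]`. -/
noncomputable def blockCenter (j : ℕ) : ℝ := ((j + 2).factorial : ℝ)

lemma succ_le_blockCenter_sub (j : ℕ) : (j : ℝ) + 1 ≤ blockCenter j - j := by
  have h1 : (1 : ℝ) ≤ ((j + 1).factorial : ℝ) := by exact_mod_cast Nat.factorial_pos _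
  have h2 : ((j + 1 : ℕ) : ℝ) ≤ ((j + 1).factorial : ℝ) := by exact_mod_cast Nat.self_le_factorial _
  have h : blockCenter j = (j + 2) * ((j + 1).factorial : ℝ) := by
    rw [blockCenter, Nat.factorial_succ (j + 1)]; push_cast; ring
  push_cast at h2
  have hj : (0 : ℝ) ≤ j := by positivity
  nlinarith

/-- The largest real of a block is small compared to the smallest real of any later block. -/
lemma blockCenter_growth {i j : ℕ} (hij : i < j) :
    (j + 1) * (blockCenter i + i) ≤ 2 * (blockCenter j - j) := by
  have h1 : blockCenter i ≤ ((j + 1).factorial : ℝ) := by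
    unfold blockCenter; exact_mod_cast Nat.factorial_le (by omega)
  have h2 : ((j + 1 : ℕ) : ℝ) ≤ ((j + 1).factorial : ℝ) := by exact_mod_cast Nat.self_le_factorial _
  have h : blockCenter j = (j + 2) * ((j + 1).factorial : ℝ) := by
    rw [blockCenter, Nat.factorial_succ (j + 1)]; push_cast; ring
  push_cast at h2
  have h3 : (i : ℝ) + 1 ≤ j := by exact_mod_cast hij
  have hj : (0 : ℝ) ≤ j := by positivity
  nlinarith

/-- A linear combination of reals from blocks with distinct large indices is dominated by the term
from the last block. -/
lemma exists_le_abs_sum_of_mem_block {ι : Type*} (s : Finset ι) (hs : s.Nonempty) (c y : ι → ℝ)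
    (j : ι → ℕ) (hinj : Set.InjOn j s) (hy : ∀ i ∈ s, |y i - blockCenter (j i)| ≤ j i) {ε : ℝ}
    (hε : ∀ i ∈ s, ε ≤ |c i|) (hj : ∀ i ∈ s, 4 * ∑ k ∈ s, |c k| ≤ ε * (j i + 1)) :
    ∃ i ∈ s, ε * (j i + 1) / 2 ≤ |∑ k ∈ s, c k * y k| := by
  classical
  obtain ⟨i, hi, hmax⟩ := s.exists_max_image j hs
  refine ⟨i, hi, ?_⟩
  -- The least element of the last block.
  set b := blockCenter (j i) - j i with hb
  have hbpos : (j i : ℝ) + 1 ≤ b := succ_le_blockCenter_sub _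
  have hjpos : (0 : ℝ) < (j i : ℝ) + 1 := by positivity
  have hother : ∀ k ∈ s.erase i, |c k * y k| ≤ |c k| * (2 * b / (j i + 1)) := by
    intro k hk
    obtain ⟨hki, hks⟩ := Finset.mem_erase.1 hk
    have hlt : j k < j i := lt_of_le_of_ne (hmax k hks) fun h => hki (hinj hks hi h)
    rw [abs_mul]
    refine mul_le_mul_of_nonneg_left ?_ (abs_nonneg _)
    rw [le_div_iff₀ hjpos]
    have h1 := blockCenter_growth hlt
    have h2 := succ_le_blockCenter_sub (j k)
    have h3 := abs_le.1 (hy k hks)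
    have h4 : |y k| ≤ blockCenter (j k) + j k :=
      abs_le.2 ⟨by linarith [h3.1, (j k).cast_nonneg (α := ℝ)], by linarith [h3.2]⟩
    nlinarith
  have hrest : |∑ k ∈ s.erase i, c k * y k| ≤ ε * b / 2 := by
    calc |∑ k ∈ s.erase i, c k * y k| ≤ ∑ k ∈ s.erase i, |c k| * (2 * b / (j i + 1)) :=
          (Finset.abs_sum_le_sum_abs _ _).trans (Finset.sum_le_sum hother)
      _ ≤ (∑ k ∈ s, |c k|) * (2 * b / (j i + 1)) := by
          rw [← Finset.sum_mul]
          refine mul_le_mul_of_nonneg_right ?_ (div_nonneg (by linarith) hjpos.le)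
          exact Finset.sum_le_sum_of_subset_of_nonneg (Finset.erase_subset _ _)
            fun _ _ _ => abs_nonneg _
      _ ≤ ε * b / 2 := by
          rw [mul_div_assoc', div_le_iff₀ hjpos]
          nlinarith [hj i hi]
  have hmain : ε * b ≤ |c i * y i| := by
    have hyi : b ≤ |y i| := by
      have := (abs_le.1 (hy i hi)).1
      exact le_trans (by linarith) (le_abs_self _)
    rw [abs_mul]
    calc ε * b ≤ |c i| * b := mul_le_mul_of_nonneg_right (hε i hi) (by linarith)
      _ ≤ |c i| * |y i| := mul_le_mul_of_nonneg_left hyi (abs_nonneg _)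
  have hε0 : 0 ≤ ε := by
    have h1 := hj i hi
    have h2 : 0 ≤ ∑ k ∈ s, |c k| := Finset.sum_nonneg fun _ _ => abs_nonneg _
    by_contra h
    push Not at h
    nlinarith
  rw [← Finset.add_sum_erase s _ hi]
  have htri := abs_sub_abs_le_abs_sub (c i * y i) (-∑ k ∈ s.erase i, c k * y k)
  rw [abs_neg, sub_neg_eq_add] at htri
  nlinarith

/-! ### Self-coding sequences -/

/-- The approximations of finite initial segments of real sequences: the pair `⟨M, q⟩` stands for
the open box of side `2 / M` around `(q 0 / M, …, q (M - 1) / M)`. -/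
abbrev GridBox : Type := Σ M : ℕ, Fin M → ℤ

/-- The sequence `x` starts in the open box coded by `Q`. -/
def GridBox.Approximates (Q : GridBox) (x : ℕ → ℝ) : Prop :=
  ∀ l : Fin Q.1, |Q.1 * x l - Q.2 l| < 1

/-- The index of the block used for a coordinate that announces the box `Q` and is allowed to
deviate from the block center by `a`. -/
def blockIndex (Q : GridBox) (a : ℕ) : ℕ := Nat.pair (Encodable.encode Q) a

lemma size_le_blockIndex (Q : GridBox) (a : ℕ) : Q.1 ≤ blockIndex Q a := by
  refine le_trans ?_ (Nat.left_le_pair _ _)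
  obtain ⟨M, q⟩ := Q
  rw [Encodable.encode_sigma_val]
  exact Nat.left_le_pair _ _

lemma le_blockIndex (Q : GridBox) (a : ℕ) : a ≤ blockIndex Q a := Nat.right_le_pair _ _

lemma blockIndex_inj {Q R : GridBox} {a b : ℕ} (h : blockIndex Q a = blockIndex R b) : Q = R :=
  Encodable.encode_injective (Nat.pair_eq_pair.1 h).1

/-- The `n`-th coordinate of `x` announces a box around the first `M ≥ N` coordinates of `x`. -/
def Announces (N n : ℕ) (x : ℕ → ℝ) : Prop :=
  ∃ Q : GridBox, N ≤ Q.1 ∧ Q.Approximates x ∧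
    ∃ a : ℕ, |x n - blockCenter (blockIndex Q a)| ≤ blockIndex Q a

/-- The real sequences whose coordinates announce longer and longer initial segments of the
sequence itself, with better and better precision. -/
def selfCoding : Set (ℕ → ℝ) := {x | ∀ N, ∀ᶠ n in atTop, Announces N n x}

lemma measurableSet_selfCoding : MeasurableSet selfCoding := by
  have h : selfCoding = ⋂ N : ℕ, ⋃ n₀ : ℕ, ⋂ n : ℕ, ⋂ _ : n₀ ≤ n, ⋃ Q : GridBox, ⋃ _ : N ≤ Q.1,
      (⋂ l : Fin Q.1, {x : ℕ → ℝ | |Q.1 * x l - Q.2 l| < 1}) ∩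
        ⋃ a : ℕ, {x : ℕ → ℝ | |x n - blockCenter (blockIndex Q a)| ≤ blockIndex Q a} := by
    ext x
    simp only [selfCoding, Announces, GridBox.Approximates, eventually_atTop, Set.mem_iInter,
      Set.mem_iUnion, Set.mem_inter_iff, Set.mem_ofPred_eq, exists_prop]
  rw [h]
  refine .iInter fun N => .iUnion fun n₀ => .iInter fun n => .iInter fun _ => .iUnion fun Q =>
    .iUnion fun _ => .inter (.iInter fun l => ?_) (.iUnion fun a => ?_)
  · exact measurableSet_lt (by fun_prop) measurable_const
  · exact measurableSet_le (by fun_prop) measurable_const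

lemma eventually_not_approximates_both {x y : ℕ → ℝ} (hxy : x ≠ y) :
    ∀ᶠ N in atTop, ∀ Q : GridBox, N ≤ Q.1 → ¬ (Q.Approximates x ∧ Q.Approximates y) := by
  obtain ⟨l, hl⟩ := Function.ne_iff.1 hxy
  have hpos : 0 < |x l - y l| := abs_pos.2 (sub_ne_zero.2 hl)
  obtain ⟨K, hK⟩ := exists_nat_gt (2 / |x l - y l|)
  filter_upwards [eventually_ge_atTop K, eventually_gt_atTop l] with N hN hlN Q hQ ⟨h1, h2⟩
  have h1' := abs_lt.1 (h1 ⟨l, hlN.trans_le hQ⟩)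
  have h2' := abs_lt.1 (h2 ⟨l, hlN.trans_le hQ⟩)
  have hKQ : (K : ℝ) ≤ Q.1 := by exact_mod_cast hN.trans hQ
  rw [div_lt_iff₀ hpos] at hK
  have hlt : |(Q.1 : ℝ) * (x l - y l)| < 2 := by
    rw [abs_lt]; constructor <;> simp only [] at h1' h2' <;> linarith [h1'.1, h1'.2, h2'.1, h2'.2]
  rw [abs_mul, Nat.abs_cast] at hlt
  nlinarith

/-- Self-coding sequences are linearly independent modulo bounded sequences: far out, distinct
sequences announce distinct boxes, so that their coordinates lie in distinct blocks. -/
theorem eq_zero_of_bounded_sum_selfCoding (s : Finset (ℕ → ℝ)) (hs : ↑s ⊆ selfCoding)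
    (c : (ℕ → ℝ) → ℝ) {B : ℝ} (hB : ∀ n, |∑ x ∈ s, c x * x n| ≤ B) : ∀ x ∈ s, c x = 0 := by
  classical
  by_contra hcon
  push Not at hcon
  obtain ⟨x₀, hx₀, hcx₀⟩ := hcon
  set t := s.filter fun x => c x ≠ 0 with ht
  have hne : t.Nonempty := ⟨x₀, by simp [ht, hx₀, hcx₀]⟩
  have hsum (n : ℕ) : ∑ x ∈ t, c x * x n = ∑ x ∈ s, c x * x n := by
    refine Finset.sum_filter_of_ne fun x _ h h0 => h (by simp [h0])
  obtain ⟨z, hz, hmin⟩ := t.exists_min_image (fun x => |c x|) hne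
  have hεpos : 0 < |c z| := abs_pos.2 (Finset.mem_filter.1 hz).2
  obtain ⟨K, hK⟩ := exists_nat_gt (max (4 * ∑ x ∈ t, |c x|) (2 * B) / |c z|)
  rw [div_lt_iff₀ hεpos, max_lt_iff] at hK
  have hsep : ∀ᶠ N in atTop, ∀ x ∈ t, ∀ y ∈ t, x ≠ y →
      ∀ Q : GridBox, N ≤ Q.1 → ¬ (Q.Approximates x ∧ Q.Approximates y) := by
    simp only [Filter.eventually_all_finset, Filter.eventually_imp_distrib_left]
    exact fun x _ y _ => eventually_not_approximates_both
  obtain ⟨N, hN, hKN⟩ := (hsep.and (eventually_ge_atTop K)).exists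
  have hann : ∀ᶠ n in atTop, ∀ x ∈ t, Announces N n x := by
    rw [Filter.eventually_all_finset]
    exact fun x hx => hs (Finset.mem_filter.1 hx).1 N
  obtain ⟨n, hn⟩ := hann.exists
  choose! Q hNQ hQ a ha using hn
  have hinj : Set.InjOn (fun x => blockIndex (Q x) (a x)) t := by
    intro x hx y hy hxy
    by_contra hne
    have hQQ := blockIndex_inj hxy
    exact hN x hx y hy hne (Q x) (hNQ x hx) ⟨hQ x hx, hQQ ▸ hQ y hy⟩
  have hlarge : ∀ x ∈ t, (K : ℝ) ≤ (blockIndex (Q x) (a x) : ℕ) := fun x hx => by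
    exact_mod_cast hKN.trans ((hNQ x hx).trans (size_le_blockIndex _ _))
  obtain ⟨x, hx, hbig⟩ := exists_le_abs_sum_of_mem_block t hne c (fun x => x n)
    (fun x => blockIndex (Q x) (a x)) hinj ha hmin
    (fun x hx => by nlinarith [hlarge x hx, hK.1])
  have := hB n
  rw [← hsum] at this
  nlinarith [hlarge x hx, hK.2]

lemma linearIndependent_selfCoding :
    LinearIndependent ℝ (Subtype.val : selfCoding → ℕ → ℝ) := by
  have h : LinearIndepOn ℝ id selfCoding := by
    rw [linearIndepOn_iff']
    intro s c hs h0
    refine eq_zero_of_bounded_sum_selfCoding s hs c (B := 0) fun n => ?_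
    have := congrFun h0 n
    simp only [Finset.sum_apply, Pi.smul_apply, id, smul_eq_mul, Pi.zero_apply] at this
    simp [this]
  exact h

lemma span_selfCoding_ne_top : Submodule.span ℝ selfCoding ≠ ⊤ := by
  intro htop
  have h1 : (1 : ℕ → ℝ) ∈ Submodule.span ℝ selfCoding := htop ▸ Submodule.mem_top
  obtain ⟨c, s, hs, -, hsum⟩ := Submodule.mem_span_iff_exists_finset_subset.1 h1
  have hn (n : ℕ) : ∑ x ∈ s, c x * x n = 1 := by
    simpa [Finset.sum_apply] using congrFun hsum n
  have hc := eq_zero_of_bounded_sum_selfCoding s hs c (B := 1) fun n => by simp [hn]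
  have := hn 0
  rw [Finset.sum_eq_zero fun x hx => by rw [hc x hx, zero_mul]] at this
  exact zero_ne_one this

/-! ### Avoiding countably many closed Haar-meager sets -/

/-- The data of a box in `ℝ^ω` restricting finitely many coordinates. -/
structure CoordBox where
  /-- The number of restricted coordinates. -/
  length : ℕ
  /-- The center; only its first `length` coordinates matter. -/
  center : ℕ → ℝ
  /-- The radius in each restricted coordinate. -/
  radius : ℝ

namespace CoordBox

/-- The sequences whose first `B.length` coordinates are `B.radius`-close to those of the center. -/
def points (B : CoordBox) : Set (ℕ → ℝ) := {x | ∀ l < B.length, |x l - B.center l| ≤ B.radius}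

/-- The box `B` is long and thin enough for a `GridBox` of size `N` to approximate all of it. -/
structure Fits (B : CoordBox) (N : ℕ) : Prop where
  le_length : N ≤ B.length
  radius_pos : 0 < B.radius
  radius_lt : N * B.radius < 1 / 2

/-- The box `B'` restricts more coordinates than `B`, and its restrictions of the first `B.length`
coordinates are at least as strong as those of `B`. -/
structure Refines (B' B : CoordBox) : Prop where
  length_lt : B.length < B'.length
  abs_add_le : ∀ l < B.length, |B'.center l - B.center l| + B'.radius ≤ B.radius

end CoordBox

/-- By the Baire category theorem, no nonempty open subset of the Cantor cube is mapped by the witness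
of Haar-meagerness into a translate of the Haar-meager set. -/
lemma IsHaarMeager.exists_translate_notMem {X : Type*} [AddGroup X] [TopologicalSpace X]
    [MeasurableSpace X] [BorelSpace X] {H : Set X} (hH : IsHaarMeager H) :
    ∃ f : (ℕ → Bool) → X, Continuous f ∧ ∀ w : X, ∀ D : Set (ℕ → Bool), IsOpen D → D.Nonempty →
      ∃ d ∈ D, w + f d ∉ H := by
  obtain ⟨-, f, hf, hmeagre⟩ := hH
  refine ⟨f, hf, fun w D hD hne => ?_⟩
  by_contra hcon
  push Not at hcon
  refine not_isMeagre_of_isOpen hD hne ((hmeagre (-w) 0).mono fun d hd => ?_)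
  exact ⟨w + f d, hcon d hd, by simp⟩

lemma exists_coordBox_subset_of_isOpen {U : Set (ℕ → ℝ)} (hU : IsOpen U) {p : ℕ → ℝ}
    (hp : p ∈ U) : ∃ m : ℕ, ∃ ε > 0, ∀ x : ℕ → ℝ, (∀ l < m, |x l - p l| ≤ ε) → x ∈ U := by
  obtain ⟨I, u, hu, hsub⟩ := isOpen_pi_iff.1 hU p hp
  have hball : ∀ i ∈ I, ∃ δ > 0, Metric.closedBall (p i) δ ⊆ u i := fun i hi =>
    Metric.nhds_basis_closedBall.mem_iff.1 ((hu i hi).1.mem_nhds (hu i hi).2)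
  choose! δ hδ hδu using hball
  obtain ⟨m, hm⟩ := I.exists_nat_subset_range
  obtain ⟨ε, hε, hεδ⟩ : ∃ ε > 0, ∀ i ∈ I, ε ≤ δ i := by
    have h : ∀ᶠ ε in 𝓝[>] (0 : ℝ), ∀ i ∈ I, ε ≤ δ i := by
      rw [Filter.eventually_all_finset]
      exact fun i hi => (eventually_le_nhds (hδ i hi)).filter_mono nhdsWithin_le_nhds
    obtain ⟨ε, h1, h2⟩ := (h.and self_mem_nhdsWithin).exists
    exact ⟨ε, h2, h1⟩
  refine ⟨m, ε, hε, fun x hx => hsub fun i hi => hδu i hi ?_⟩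
  rw [Metric.mem_closedBall, Real.dist_eq]
  exact (hx i (Finset.mem_range.1 (hm hi))).trans (hεδ i hi)

lemma CoordBox.Fits.exists_approximates {B : CoordBox} {N : ℕ} (hB : B.Fits N) :
    ∃ Q : GridBox, Q.1 = N ∧ ∀ x ∈ B.points, Q.Approximates x := by
  refine ⟨⟨N, fun l => round (N * B.center l)⟩, rfl, fun x hx l => ?_⟩
  have h1 : |N * x l - N * B.center l| ≤ N * B.radius := by
    rw [← mul_sub, abs_mul, Nat.abs_cast]
    exact mul_le_mul_of_nonneg_left (hx l (l.2.trans_le hB.le_length)) N.cast_nonneg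
  calc |N * x l - round (N * B.center l)|
      ≤ |N * x l - N * B.center l| + |N * B.center l - round (N * B.center l)| :=
        abs_sub_le _ _ _
    _ < 1 / 2 + 1 / 2 := add_lt_add_of_lt_of_le (h1.trans_lt hB.radius_lt) (abs_sub_round _)
    _ = 1 := by norm_num

lemma CoordBox.Refines.points_subset {B B' : CoordBox} (h : B'.Refines B) :
    B'.points ⊆ B.points := fun x hx l hl => by
  have h1 := hx l (hl.trans h.length_lt)
  have h2 := h.abs_add_le l hl
  linarith [abs_sub_le (x l) (B'.center l) (B.center l)]

/-- One fusion step. The witness of Haar-meagerness of `H`, restricted to a small open subset of the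
Cantor cube, is translated into `B` in the coordinates restricted by `B`, and into blocks announcing
`B` in all other coordinates; some point of the translate lies outside `H`. -/
lemma IsHaarMeager.exists_refinement {H : Set (ℕ → ℝ)} (hH : IsHaarMeager H) (hcl : IsClosed H)
    {N : ℕ} {B : CoordBox} (hB : B.Fits N) :
    ∃ B' : CoordBox, B'.Fits (N + 1) ∧ B'.Refines B ∧ ∀ x ∈ B'.points, x ∉ H ∧
      ∀ n, B.length ≤ n → n < B'.length → Announces N n x := by
  obtain ⟨f, hf, hfH⟩ := hH.exists_translate_notMem
  obtain ⟨Q, rfl, hQ⟩ := hB.exists_approximates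
  -- The summand `1` leaves room for the radius of the new box.
  have hbound : ∀ n, ∃ a : ℕ, ∀ d, |f d n| + 1 ≤ a := fun n => by
    have hc : Continuous fun d => f d n := (continuous_apply n).comp hf
    obtain ⟨C, hC⟩ := isCompact_univ.exists_bound_of_continuousOn hc.continuousOn
    obtain ⟨a, ha⟩ := exists_nat_ge (C + 1)
    exact ⟨a, fun d => by have := hC d trivial; rw [Real.norm_eq_abs] at this; linarith⟩
  choose a ha using hbound
  -- On `D` the first `B.length` coordinates of `f` vary so little that a translate stays in `B`.
  let d₀ : ℕ → Bool := fun _ => false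
  let D : Set (ℕ → Bool) := ⋂ l ∈ Finset.range B.length, {d | |f d l - f d₀ l| < B.radius / 2}
  have hD : IsOpen D := isOpen_biInter_finset fun l _ =>
    isOpen_lt (((continuous_apply l).comp hf).sub continuous_const).abs continuous_const
  have hd₀ : d₀ ∈ D := by simp [D, hB.radius_pos]
  let w : ℕ → ℝ := fun n =>
    if n < B.length then B.center n - f d₀ n else blockCenter (blockIndex Q (a n))
  obtain ⟨d, hdD, hdH⟩ := hfH w D hD ⟨d₀, hd₀⟩
  set p := w + f d with hp
  obtain ⟨m, ε, hε, hU⟩ := exists_coordBox_subset_of_isOpen hcl.isOpen_compl hdH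
  set r := min (min ε (B.radius / 2)) (min 1 (1 / (4 * (Q.1 + 1)))) with hr
  have hr0 : 0 < r := by have := hB.radius_pos; positivity
  have hrε : r ≤ ε := (min_le_left _ _).trans (min_le_left _ _)
  have hrB : r ≤ B.radius / 2 := (min_le_left _ _).trans (min_le_right _ _)
  have hr1 : r ≤ 1 := (min_le_right _ _).trans (min_le_left _ _)
  have hrQ : r ≤ 1 / (4 * (Q.1 + 1)) := (min_le_right _ _).trans (min_le_right _ _)
  have href : CoordBox.Refines ⟨max m (B.length + 1), p, r⟩ B := by
    refine ⟨(Nat.lt_succ_self _).trans_le (le_max_right _ _), fun l hl => ?_⟩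
    have h1 : |f d l - f d₀ l| < B.radius / 2 := by
      simpa using Set.mem_iInter₂.1 hdD l (Finset.mem_range.2 hl)
    have h2 : p l - B.center l = f d l - f d₀ l := by simp [hp, w, hl]; ring
    simp only [h2]
    linarith
  refine ⟨_, ⟨?_, hr0, ?_⟩, href, fun x hx => ⟨?_, fun n hn hn' => ?_⟩⟩
  · exact (Nat.succ_le_succ hB.le_length).trans (le_max_right _ _)
  · rw [le_div_iff₀ (by positivity)] at hrQ
    have : ((Q.1 : ℝ) + 1) * r < 1 / 2 := by linarith
    exact_mod_cast this
  · exact hU x fun l hl => (hx l (hl.trans_le (le_max_left _ _))).trans hrε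
  · refine ⟨Q, le_rfl, hQ x (href.points_subset hx), a n, ?_⟩
    have h1 : |x n - p n| ≤ r := hx n hn'
    have h2 : p n = blockCenter (blockIndex Q (a n)) + f d n := by simp [hp, w, hn.not_gt]
    have h3 : (a n : ℝ) ≤ blockIndex Q (a n) := by exact_mod_cast le_blockIndex Q (a n)
    have h4 := ha n d
    rw [h2] at h1
    rw [abs_le] at h1 ⊢
    have h5 := abs_le.1 (le_refl |f d n|)
    constructor <;> linarith [h1.1, h1.2, h5.1, h5.2]

/-- The restrictions of each single coordinate form, from some stage on, a decreasing sequence of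
compact intervals. -/
lemma CoordBox.exists_mem_points_of_refines {B : ℕ → CoordBox} (h0 : ∀ i, 0 < (B i).radius)
    (h : ∀ i, (B (i + 1)).Refines (B i)) : ∃ x, ∀ i, x ∈ (B i).points := by
  have hmono : StrictMono fun i => (B i).length :=
    strictMono_nat_of_lt_succ fun i => (h i).length_lt
  -- The interval to which `B i` restricts the coordinate `l`.
  let J (l i : ℕ) : Set ℝ := Metric.closedBall ((B i).center l) (B i).radius
  have hJ {l i : ℕ} (hl : l < (B i).length) : J l (i + 1) ⊆ J l i := by
    refine Metric.closedBall_subset_closedBall' ?_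
    rw [Real.dist_eq, add_comm]
    exact (h i).abs_add_le l hl
  have hlen (l i : ℕ) : l < (B (l + 1 + i)).length :=
    (by omega : l < l + 1 + i).trans_le hmono.le_apply
  have hx (l : ℕ) : (⋂ i, J l (l + 1 + i)).Nonempty :=
    IsCompact.nonempty_iInter_of_sequence_nonempty_isCompact_isClosed _
      (fun i => hJ (hlen l i)) (fun i => Metric.nonempty_closedBall.2 (h0 _).le)
      (isCompact_closedBall _ _) fun i => Metric.isClosed_closedBall
  choose x hx using hx
  have hxJ (l i k : ℕ) (hl : l < (B i).length) : x l ∈ J l (i + k) → x l ∈ J l i := by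
    induction k with
    | zero => exact id
    | succ k ih =>
      exact fun hk => ih (hJ (hl.trans_le (hmono.monotone (Nat.le_add_right i k))) hk)
  refine ⟨x, fun i l hl => hxJ l i (l + 1) hl ?_⟩
  rw [add_comm]
  exact Set.mem_iInter.1 (hx l) i

/-- The self-coding sequences are not covered by countably many closed Haar-meager sets. -/
theorem exists_mem_selfCoding_forall_notMem {H : ℕ → Set (ℕ → ℝ)}
    (hcl : ∀ i, IsClosed (H i)) (hH : ∀ i, IsHaarMeager (H i)) :
    ∃ x ∈ selfCoding, ∀ i, x ∉ H i := by
  have hstep (N : ℕ) (B : {B : CoordBox // B.Fits N}) :=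
    (hH N).exists_refinement (hcl N) B.2
  choose next hfits href hnext using hstep
  let B : ∀ N : ℕ, {B : CoordBox // B.Fits N} := fun N =>
    Nat.rec ⟨⟨0, 0, 1⟩, ⟨le_rfl, one_pos, by norm_num⟩⟩ (fun N B => ⟨next N B, hfits N B⟩) N
  have hmono : StrictMono fun i => (B i).1.length :=
    strictMono_nat_of_lt_succ fun i => (href i (B i)).length_lt
  obtain ⟨x, hx⟩ := CoordBox.exists_mem_points_of_refines (B := fun i => (B i).1)
    (fun i => (B i).2.radius_pos) fun i => href i (B i)
  refine ⟨x, fun N => ?_, fun i => (hnext i (B i) x (hx (i + 1))).1⟩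
  filter_upwards [eventually_ge_atTop (B N).1.length] with n hn
  -- The coordinate `n` was fixed at a stage `i ≥ N`.
  obtain ⟨i, hNi, hi, hi'⟩ : ∃ i, N ≤ i ∧ (B i).1.length ≤ n ∧ n < (B (i + 1)).1.length := by
    have hex : ∃ k, n < (B k).1.length := ⟨n + 1, n.lt_succ_self.trans_le hmono.le_apply⟩
    obtain ⟨k, hk, hkmin⟩ : ∃ k, n < (B k).1.length ∧ ∀ j < k, ¬ n < (B j).1.length :=
      ⟨Nat.find hex, Nat.find_spec hex, fun j => Nat.find_min hex⟩
    have hNk : N < k := hmono.lt_iff_lt.1 (hn.trans_lt hk)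
    obtain ⟨i, rfl⟩ : ∃ i, k = i + 1 := ⟨k - 1, by omega⟩
    exact ⟨i, by omega, not_lt.1 (hkmin i (by omega)), hk⟩
  obtain ⟨Q, hQ, hrest⟩ := (hnext i (B i) x (hx (i + 1))).2 n hi hi'
  exact ⟨Q, hNi.trans hQ, hrest⟩

theorem theorem1p2 :
    ∃ L : Submodule ℝ (ℕ → ℝ),
      MeasurableSet (L : Set (ℕ → ℝ)) ∧
      IsHaarMeager (L : Set (ℕ → ℝ)) ∧
      IsHaarNull (L : Set (ℕ → ℝ)) ∧
      ¬ ∃ F : Set (Set (ℕ → ℝ)), F.Countable ∧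
          (∀ H ∈ F, IsClosed H ∧ IsHaarMeager H) ∧
          (L : Set (ℕ → ℝ)) ⊆ ⋃₀ F := by
  have hL : MeasurableSet (Submodule.span ℝ selfCoding : Set (ℕ → ℝ)) := by
    have := measurableSet_selfCoding.standardBorel
    have h := linearIndependent_selfCoding.measurableSet_span measurable_subtype_coe
    rwa [Subtype.range_coe] at h
  refine ⟨Submodule.span ℝ selfCoding, hL,
    Submodule.isHaarMeager_of_ne_top _ hL span_selfCoding_ne_top,
    Submodule.isHaarNull_of_ne_top _ hL span_selfCoding_ne_top, ?_⟩
  rintro ⟨F, hF, hFH, hcover⟩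
  obtain ⟨H₀, hH₀, -⟩ := hcover (Submodule.zero_mem _)
  obtain ⟨H, rfl⟩ := hF.exists_eq_range ⟨H₀, hH₀⟩
  obtain ⟨x, hx, hxH⟩ := exists_mem_selfCoding_forall_notMem
    (fun i => (hFH _ (Set.mem_range_self i)).1) fun i => (hFH _ (Set.mem_range_self i)).2
  obtain ⟨_, ⟨i, rfl⟩, hi⟩ := hcover (Submodule.subset_span hx)
  exact hxH i hi
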